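/- **Proposition 6.6.** Let $d\ge 1$ be an integer and let $\varepsilon,c$ be real numbers with $c\ge 1$ and $0<\varepsilon\le c$. Let $G\subset\mathbb{R}^d$ be an arbitrary finite set and $\mathcal{H}=\operatorname{Span}\{|\boldsymbol{x}\rangle:\boldsymbol{x}\in G\}$. For $f:\mathbb{R}^d\to\mathbb{R}$ let $\mathrm{O}_f:|\boldsymbol{x}\rangle\mapsto e^{if(\boldsymbol{x})}|\boldsymbol{x}\rangle$ be the phase oracle acting on $\mathcal{H}$. Suppose that $\mathcal{A}$ is a $T$-query quantum algorithm with query access to $\mathrm{O}_f$: on $\mathcal{H}\otimes\mathbb{C}^w$, for some finite workspace dimension $w$, it starts in a unit vector, makes $T$ queries, each followed by a unitary, and finally measures in the computational basis and outputs a real $d\times d$ matrix determined by the measured label. The initial vector, the unitaries and the output rule do not depend on $f$, and each query may be controlled by the workspace and may apply $\mathrm{O}_f$ or $\mathrm{O}_f^{\dagger}$. Suppose that for every (real-)analytic function $f:\mathbb{R}^d\to\mathbb{R}$ satisfying $$|\partial^\alpha f(\boldsymbol{0})|\le c^t\,t^{t/2}\qquad\text{for all integers } t\ge 1 \text{ and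 all } \alpha\in\mathbb{Z}_{\ge 0}^d \text{ with } |\alpha|=t,$$ the algorithm outputs, with probability at least $2/3$, a matrix $\widetilde{\mathbf H}$ with $|\widetilde{\mathbf H}_{jk}-\partial_j\partial_k f(\boldsymbol{0})|\le\varepsilon$ for all $j,k$. Then $$T>\frac{cd}{\varepsilon},$$ and in particular $T\in\Omega(d/\varepsilon)$. -/

import Mathlib

noncomputable section

/-- The partial derivative `∂ᵢ f` of a real function on `ℝᵈ`. -/
def partialDeriv {d : ℕ} (i : Fin d) (f : EuclideanSpace ℝ (Fin d) → ℝ) :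
    EuclideanSpace ℝ (Fin d) → ℝ :=
  fun x => lineDeriv ℝ f x (EuclideanSpace.single i (1 : ℝ))

/-- For a multi-index `α`, the higher-order partial derivative
`∂^α f = ∂₁^{α₁} ∂₂^{α₂} ⋯ ∂_d^{α_d} f`. -/
def multiDeriv {d : ℕ} (α : Fin d → ℕ) (f : EuclideanSpace ℝ (Fin d) → ℝ) :
    EuclideanSpace ℝ (Fin d) → ℝ :=
  (List.finRange d).foldr (fun i g => (partialDeriv i)^[α i] g) f

/-- The Hessian matrix `(∂ⱼ ∂ₖ f (x))ⱼₖ`. -/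
def hessianMatrix {d : ℕ} (f : EuclideanSpace ℝ (Fin d) → ℝ) (x : EuclideanSpace ℝ (Fin d)) :
    Matrix (Fin d) (Fin d) ℝ :=
  Matrix.of fun j k => partialDeriv j (partialDeriv k f) x

/-- `M` is an `ε`-approximation of `N` in the max norm `‖A‖_max = max_{j,k} |a_{jk}|`. -/
def IsMaxNormApprox {d : ℕ} (ε : ℝ) (M N : Matrix (Fin d) (Fin d) ℝ) : Prop :=
  ∀ j k, |M j k - N j k| ≤ ε

/-- The functions of the promise: analytic `f : ℝᵈ → ℝ` with `|∂^α f(0)| ≤ c^t t^{t/2}` for all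
positive integers `t` and all multi-indices `α` with `|α| = t`. -/
def SmoothClass (d : ℕ) (c : ℝ) (f : EuclideanSpace ℝ (Fin d) → ℝ) : Prop :=
  AnalyticOnNhd ℝ f Set.univ ∧
    ∀ t : ℕ, 1 ≤ t → ∀ α : Fin d → ℕ, ∑ i, α i = t →
      |multiDeriv α f 0| ≤ c ^ t * (t : ℝ) ^ ((t : ℝ) / 2)

/-- A quantum query algorithm with access to a phase oracle on `Span {|x⟩ : x ∈ G}`, whose output
is a real `d × d` matrix. Nothing in it depends on the queried function.

The state space is `Span {|x⟩ : x ∈ G} ⊗ ℂʷ`, with orthonormal basis `|x, a⟩`, where `w` is the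
dimension of the workspace. The algorithm starts in the unit vector `init`. For `t < numQueries`,
step `t` consists of one query followed by the unitary `U t`; the values of `U` and `mode` at
`t ≥ numQueries` are not used. At the end, all registers are measured in the basis `|x, a⟩`, and
`output` maps the observed label to the returned matrix.

The query of step `t` may be controlled by the workspace and may use the inverse oracle: on
workspace label `a`, it acts as the oracle, its inverse or the identity when `mode t a` is
`1`, `-1` or `0`. The uncontrolled oracle is the case that `mode t` is constantly `1`. -/
structure PhaseQueryAlgorithm {d : ℕ} (G : Finset (EuclideanSpace ℝ (Fin d))) where
  numQueries : ℕ
  workDim : ℕ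
  init : EuclideanSpace ℂ (G × Fin workDim)
  norm_init : ‖init‖ = 1
  mode : ℕ → Fin workDim → SignType
  U : ℕ → EuclideanSpace ℂ (G × Fin workDim) ≃ₗᵢ[ℂ] EuclideanSpace ℂ (G × Fin workDim)
  output : G × Fin workDim → Matrix (Fin d) (Fin d) ℝ

namespace PhaseQueryAlgorithm

/-- One query to the phase oracle `O_f : |x⟩ ↦ e^{i f(x)} |x⟩`: the diagonal unitary
`|x, a⟩ ↦ e^{i s(a) f(x)} |x, a⟩`, where `s(a) ∈ {-1, 0, 1}` is the mode of the query. -/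
def query {d w : ℕ} {G : Finset (EuclideanSpace ℝ (Fin d))}
    (s : Fin w → SignType) (f : EuclideanSpace ℝ (Fin d) → ℝ)
    (ψ : EuclideanSpace ℂ (G × Fin w)) : EuclideanSpace ℂ (G × Fin w) :=
  WithLp.toLp 2 fun p =>
    Complex.exp (Complex.I * (((s p.2 : ℝ) * f (p.1 : EuclideanSpace ℝ (Fin d)) : ℝ) : ℂ)) * ψ p

/-- The state of the algorithm after `t` steps, when the oracle is `O_f`. -/
def state {d : ℕ} {G : Finset (EuclideanSpace ℝ (Fin d))} (A : PhaseQueryAlgorithm G)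
    (f : EuclideanSpace ℝ (Fin d) → ℝ) : ℕ → EuclideanSpace ℂ (G × Fin A.workDim)
  | 0 => A.init
  | t + 1 => A.U t (query (A.mode t) f (A.state f t))

open Classical in
/-- The probability, by the Born rule, that the output of the algorithm is an `ε`-approximation
of the Hessian of `f` at `0`, when the oracle is `O_f`. -/
def successProb {d : ℕ} {G : Finset (EuclideanSpace ℝ (Fin d))} (A : PhaseQueryAlgorithm G)
    (f : EuclideanSpace ℝ (Fin d) → ℝ) (ε : ℝ) : ℝ :=
  ∑ p : G × Fin A.workDim,
    if IsMaxNormApprox ε (A.output p) (hessianMatrix f 0) then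
      ‖A.state f A.numQueries p‖ ^ 2
    else 0

end PhaseQueryAlgorithm

end

/-!
The proof is a hybrid argument for a family of functions that are close to each other but whose
Hessians at the origin have different sign patterns.

With `y = c x`, take the bumps `w y_j y_k exp (-‖y‖²)` for `j ≤ k`, where `w = 1/2` on the diagonal
and `w = 1` off it (`gaussBump`). The reference function `g` has all coefficients `-b`, where
`c² b = 1.01 ε`, and `f_{jk}` is `g` with the sign of one coefficient flipped. The upper triangle of
the Hessian of such a function consists of the entries `± 1.01 ε` (`hessianMatrix_bumpSum`), so an
`ε`-approximation of it shows all the signs, and no matrix approximates two of these Hessians.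

*Promise.* A bump is a product of functions `yᵉ exp (-y²)` of one variable, whose derivatives at `0`
are known in closed form. Hence every bump has few nonzero derivatives at the origin: a given
`∂^α` sees either a single off-diagonal bump or at most the diagonal ones. This bounds the
derivatives of the whole combination by a single product of factors `(2m)! / m!` or
`(2m + 1)! / m!`, which are supermultiplicative, and so by `c^t t^{t/2}` (`smoothClass_bumpSum`).
The inequality `ε ≤ c ≤ c²` enters through `b ≤ 1.01`.

*Closeness.* The sum of `(f_{jk} - g)²` over the family is bounded at each point by a constant times
`(ε / c²)²`, independently of the dimension (`sum_sq_gaussBump_sub_le`). A constant may be added to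
`f_{jk}` without changing its derivatives. For the diagonal bumps, which are nonnegative, this makes
the bound smaller, which is what gives the constant `1` in the theorem for small `d`.

*Hybrid argument.* By the triangle inequality, the final state for `f_{jk}` differs from the one for
`g` by at most the sum over the `T` queries of the effect of exchanging the oracles on the state of
the run on `g`. Squared and summed over the family, this is at most `T²` times the bound above
(`PhaseQueryAlgorithm.sum_norm_sq_state_sub_le`). On the other hand, the run on `g` returns answers
valid for the `d (d + 1) / 2` functions `f_{jk}` with total probability at most `1/3`, whereas the
run on `f_{jk}` returns one with probability at least `2/3`, so the sum of the squared distances is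
of order `d²` (`PhaseQueryAlgorithm.card_mul_le_of_successProb`). Comparing the two gives
`T > c² d / ε`, which is at least `c d / ε`.
-/

noncomputable section

/-! ### Partial derivatives of sums of products of one-variable functions -/

theorem partialDeriv_sum_prod {d : ℕ} {κ : Type*} (S : Finset κ) (C : ℝ) (v : κ → ℝ)
    (g : κ → Fin d → ℝ → ℝ) (hg : ∀ q i, Differentiable ℝ (g q i)) (i : Fin d) :
    partialDeriv i (fun x => C + ∑ q ∈ S, v q * ∏ k, g q k (x k)) =
      fun x => ∑ q ∈ S, v q * ∏ k, (if k = i then deriv (g q k) else g q k) (x k) := by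
  funext x
  have h1 : ∀ q, HasDerivAt
      (fun t : ℝ => ∏ k, g q k ((x + t • EuclideanSpace.single i (1 : ℝ)) k))
      (∏ k, (if k = i then deriv (g q k) else g q k) (x k)) 0 := by
    intro q
    have h2 : (fun t : ℝ => ∏ k, g q k ((x + t • EuclideanSpace.single i (1 : ℝ)) k)) =
        fun t => g q i (x i + t) * ∏ k ∈ Finset.univ.erase i, g q k (x k) := by
      funext t
      rw [← Finset.mul_prod_erase _ _ (Finset.mem_univ i)]
      congr 1
      · simp
      · refine Finset.prod_congr rfl fun k hk => ?_
        simp [Finset.ne_of_mem_erase hk]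
    rw [h2, ← Finset.mul_prod_erase _ _ (Finset.mem_univ i)]
    have h3 : ∏ k ∈ Finset.univ.erase i, (if k = i then deriv (g q k) else g q k) (x k) =
        ∏ k ∈ Finset.univ.erase i, g q k (x k) := by
      refine Finset.prod_congr rfl fun k hk => ?_
      simp [Finset.ne_of_mem_erase hk]
    rw [h3, if_pos rfl]
    refine HasDerivAt.mul_const ?_ _
    have h4 : HasDerivAt (g q i) (deriv (g q i) (x i)) (x i + 0) := by
      simpa using (hg q i (x i)).hasDerivAt
    exact h4.comp_const_add (x i) 0
  have h5 := (HasDerivAt.fun_sum (u := S) fun q _ => (h1 q).const_mul (v q)).const_add C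
  exact h5.deriv

/-- Applying the partial derivatives listed in `L` amounts to differentiating the factor in the
`k`-th coordinate as many times as `k` occurs in `L`. -/
theorem foldr_partialDeriv_sum_prod {d : ℕ} {κ : Type*} (S : Finset κ) (C : ℝ) (v : κ → ℝ)
    (g : κ → Fin d → ℝ → ℝ) (hg : ∀ q i, ContDiff ℝ (⊤ : ℕ∞) (g q i)) (L : List (Fin d)) :
    L.foldr partialDeriv (fun x => C + ∑ q ∈ S, v q * ∏ k, g q k (x k)) =
      fun x => (if L = [] then C else 0) +
        ∑ q ∈ S, v q * ∏ k, iteratedDeriv (L.count k) (g q k) (x k) := by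
  induction L with
  | nil => simp
  | cons i L ih =>
    rw [List.foldr_cons, ih, partialDeriv_sum_prod S _ v
      (fun q k => iteratedDeriv (L.count k) (g q k))]
    · funext x
      simp only [reduceCtorEq, if_false, zero_add]
      refine Finset.sum_congr rfl fun q _ => ?_
      congr 1
      refine Finset.prod_congr rfl fun k _ => ?_
      by_cases hk : k = i
      · subst hk
        simp [iteratedDeriv_succ]
      · simp [hk, Ne.symm hk]
    · intro q k
      exact (hg q k).differentiable_iteratedDeriv _ (by exact_mod_cast WithTop.coe_lt_top _)

/-- The list of directions in which `∂^α` differentiates, with multiplicity. -/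
def directions {d : ℕ} (α : Fin d → ℕ) : List (Fin d) :=
  (List.finRange d).flatMap fun i => List.replicate (α i) i

theorem multiDeriv_eq_foldr {d : ℕ} (α : Fin d → ℕ) (f : EuclideanSpace ℝ (Fin d) → ℝ) :
    multiDeriv α f = (directions α).foldr partialDeriv f := by
  have h1 : ∀ (i : Fin d) (n : ℕ) (g : EuclideanSpace ℝ (Fin d) → ℝ),
      (List.replicate n i).foldr partialDeriv g = (partialDeriv i)^[n] g := by
    intro i n g
    induction n with
    | zero => rfl
    | succ n ih => rw [List.replicate_succ, List.foldr_cons, ih, Function.iterate_succ_apply']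
  unfold multiDeriv directions
  induction List.finRange d with
  | nil => rfl
  | cons i L ih => rw [List.flatMap_cons, List.foldr_append, ← ih, h1, List.foldr_cons]

theorem count_directions {d : ℕ} (α : Fin d → ℕ) (k : Fin d) :
    (directions α).count k = α k := by
  unfold directions
  rw [List.count_flatMap, ← Fin.sum_univ_def]
  simp [List.count_replicate]

/-! ### Derivatives at the origin of Gaussians times monomials -/

/-- The one-variable function `y ↦ yᵉ exp (-y²)`. -/
def gaussMonomial (e : ℕ) (y : ℝ) : ℝ := y ^ e * Real.exp (-y ^ 2)

/-- The `n`-th derivative at the origin of `y ↦ yᵉ exp (-y²)`. -/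
def gaussJet (e n : ℕ) : ℝ := iteratedDeriv n (gaussMonomial e) 0

theorem contDiff_gaussMonomial (e : ℕ) {n : WithTop ℕ∞} : ContDiff ℝ n (gaussMonomial e) := by
  unfold gaussMonomial
  fun_prop

theorem differentiable_iteratedDeriv_gaussMonomial (e n : ℕ) :
    Differentiable ℝ (iteratedDeriv n (gaussMonomial e)) :=
  (contDiff_gaussMonomial e (n := (⊤ : ℕ∞))).differentiable_iteratedDeriv _
    (by exact_mod_cast WithTop.coe_lt_top _)

theorem deriv_gaussMonomial_zero :
    deriv (gaussMonomial 0) = fun y => -2 * gaussMonomial 1 y := by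
  funext y
  have h := (((hasDerivAt_id y).pow 2).neg.exp)
  have h' : HasDerivAt (gaussMonomial 0) (-2 * gaussMonomial 1 y) y := by
    convert h using 1
    · funext z; simp [gaussMonomial]
    · simp [gaussMonomial]; ring
  exact h'.deriv

theorem deriv_gaussMonomial_one :
    deriv (gaussMonomial 1) = fun y => gaussMonomial 0 y - 2 * gaussMonomial 2 y := by
  funext y
  have h : HasDerivAt (fun z : ℝ => z * Real.exp (-z ^ 2)) _ y :=
    (hasDerivAt_id y).fun_mul ((hasDerivAt_id y).fun_pow 2).fun_neg.exp
  have h' : HasDerivAt (gaussMonomial 1) (gaussMonomial 0 y - 2 * gaussMonomial 2 y) y := by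
    have h2 : gaussMonomial 1 = fun z : ℝ => z * Real.exp (-z ^ 2) := by
      funext z; simp [gaussMonomial]
    rw [h2]
    refine h.congr_deriv ?_
    simp [gaussMonomial]; ring
  exact h'.deriv

theorem gaussJet_one (n : ℕ) : gaussJet 1 n = -gaussJet 0 (n + 1) / 2 := by
  unfold gaussJet
  rw [iteratedDeriv_succ', deriv_gaussMonomial_zero]
  rw [iteratedDeriv_const_mul_field]
  ring

theorem iteratedDeriv_gaussMonomial_rec (n : ℕ) :
    iteratedDeriv (n + 2) (gaussMonomial 0) = fun y =>
      -2 * (y * iteratedDeriv (n + 1) (gaussMonomial 0) y) -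
        2 * (n + 1) * iteratedDeriv n (gaussMonomial 0) y := by
  induction n with
  | zero =>
    funext y
    have : iteratedDeriv 2 (gaussMonomial 0) y =
        -2 * (gaussMonomial 0 y - 2 * gaussMonomial 2 y) := by
      rw [iteratedDeriv_succ', deriv_gaussMonomial_zero, iteratedDeriv_const_mul_field,
        iteratedDeriv_one, deriv_gaussMonomial_one]
    rw [this, zero_add, iteratedDeriv_one, deriv_gaussMonomial_zero, iteratedDeriv_zero]
    simp [gaussMonomial]; ring
  | succ n ih =>
    rw [iteratedDeriv_succ, ih]
    funext y
    have hd := fun n => (differentiable_iteratedDeriv_gaussMonomial 0 n y).hasDerivAt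
    have h := (((hasDerivAt_id y).mul (hd (n + 1))).const_mul (-2)).sub
      ((hd n).const_mul (2 * ((n : ℝ) + 1)))
    refine h.deriv.trans ?_
    rw [← iteratedDeriv_succ, ← iteratedDeriv_succ]
    rw [show iteratedDeriv (n + 1 + 1) (gaussMonomial 0) y = _ from congrFun ih y]
    simp only [id]
    push_cast
    ring

theorem gaussJet_zero_zero : gaussJet 0 0 = 1 := by simp [gaussJet, gaussMonomial]

theorem gaussJet_zero_one : gaussJet 0 1 = 0 := by
  simp [gaussJet, deriv_gaussMonomial_zero, gaussMonomial]

theorem gaussJet_zero_add_two (n : ℕ) : gaussJet 0 (n + 2) = -(2 * (n + 1)) * gaussJet 0 n := by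
  simp [gaussJet, iteratedDeriv_gaussMonomial_rec]

theorem gaussJet_two (n : ℕ) : gaussJet 2 n = -(n / 2) * gaussJet 0 n := by
  have h1 : gaussMonomial 2 = fun y =>
      (1 / 4) * (iteratedDeriv 2 (gaussMonomial 0) y + 2 * gaussMonomial 0 y) := by
    funext y
    rw [iteratedDeriv_succ', deriv_gaussMonomial_zero, iteratedDeriv_const_mul_field,
        iteratedDeriv_one, deriv_gaussMonomial_one]
    ring
  have h2 : gaussJet 2 n = (1 / 4) * (gaussJet 0 (n + 2) + 2 * gaussJet 0 n) := by
    unfold gaussJet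
    conv_lhs => rw [h1]
    rw [iteratedDeriv_const_mul_field, iteratedDeriv_fun_add, iteratedDeriv_const_mul_field]
    · congr 2
      rw [iteratedDeriv_eq_iterate, iteratedDeriv_eq_iterate, iteratedDeriv_eq_iterate,
        ← Function.iterate_add_apply]
    · rw [iteratedDeriv_eq_iterate]
      exact ((contDiff_gaussMonomial 0 (n := (⊤ : ℕ∞))).iterate_deriv 2).contDiffAt.of_le
        (by exact_mod_cast le_top)
    · exact (contDiff_const.mul (contDiff_gaussMonomial 0)).contDiffAt
  rw [h2, gaussJet_zero_add_two]
  ring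

/-- `(2m)! / m!` as a product: the `2m`-th derivative of `exp (-y²)` at `0`, up to sign. -/
def evenJet (m : ℕ) : ℝ := ∏ i ∈ Finset.range m, (4 * i + 2 : ℝ)

/-- `(2m+1)! / m!` as a product: the `(2m+1)`-st derivative of `y exp (-y²)` at `0`, up to sign. -/
def oddJet (m : ℕ) : ℝ := ∏ i ∈ Finset.range m, (4 * i + 6 : ℝ)

theorem evenJet_succ (m : ℕ) : evenJet (m + 1) = (4 * m + 2) * evenJet m := by
  rw [evenJet, Finset.prod_range_succ, mul_comm, evenJet]

theorem oddJet_succ (m : ℕ) : oddJet (m + 1) = (4 * m + 6) * oddJet m := by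
  rw [oddJet, Finset.prod_range_succ, mul_comm, oddJet]

theorem evenJet_nonneg (m : ℕ) : 0 ≤ evenJet m := Finset.prod_nonneg fun _ _ => by positivity

theorem oddJet_nonneg (m : ℕ) : 0 ≤ oddJet m := Finset.prod_nonneg fun _ _ => by positivity

theorem evenJet_succ_eq (m : ℕ) : evenJet (m + 1) = 2 * oddJet m := by
  induction m with
  | zero => simp [evenJet, oddJet]
  | succ m ih => rw [evenJet_succ, ih, oddJet_succ]; push_cast; ring

theorem evenJet_le_oddJet (m : ℕ) : evenJet m ≤ oddJet m :=
  Finset.prod_le_prod (fun _ _ => by positivity) fun _ _ => by linarith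

theorem evenJet_mul_le (p q : ℕ) : evenJet p * evenJet q ≤ evenJet (p + q) := by
  induction q with
  | zero => simp [evenJet]
  | succ q ih =>
    rw [← add_assoc, evenJet_succ, evenJet_succ]
    have h0 := evenJet_nonneg (p + q)
    calc evenJet p * ((4 * q + 2) * evenJet q) = (4 * q + 2) * (evenJet p * evenJet q) := by ring
      _ ≤ (4 * q + 2) * evenJet (p + q) := by gcongr
      _ ≤ _ := by gcongr; linarith [(p.cast_nonneg : (0 : ℝ) ≤ p)]

theorem oddJet_mul_le (p q : ℕ) : oddJet p * oddJet q ≤ oddJet (p + q) := by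
  induction q with
  | zero => simp [oddJet]
  | succ q ih =>
    rw [← add_assoc, oddJet_succ, oddJet_succ]
    have h0 := oddJet_nonneg (p + q)
    calc oddJet p * ((4 * q + 6) * oddJet q) = (4 * q + 6) * (oddJet p * oddJet q) := by ring
      _ ≤ (4 * q + 6) * oddJet (p + q) := by gcongr
      _ ≤ _ := by gcongr; linarith [(p.cast_nonneg : (0 : ℝ) ≤ p)]

theorem prod_evenJet_le {ι : Type*} (s : Finset ι) (m : ι → ℕ) :
    ∏ i ∈ s, evenJet (m i) ≤ evenJet (∑ i ∈ s, m i) := by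
  classical
  induction s using Finset.induction_on with
  | empty => simp [evenJet]
  | insert a s ha ih =>
    rw [Finset.prod_insert ha, Finset.sum_insert ha]
    exact (mul_le_mul_of_nonneg_left ih (evenJet_nonneg _)).trans (evenJet_mul_le _ _)

theorem prod_oddJet_le {ι : Type*} (s : Finset ι) (m : ι → ℕ) :
    ∏ i ∈ s, oddJet (m i) ≤ oddJet (∑ i ∈ s, m i) := by
  classical
  induction s using Finset.induction_on with
  | empty => simp [oddJet]
  | insert a s ha ih =>
    rw [Finset.prod_insert ha, Finset.sum_insert ha]
    exact (mul_le_mul_of_nonneg_left ih (oddJet_nonneg _)).trans (oddJet_mul_le _ _)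

theorem abs_gaussJet_even (m : ℕ) : |gaussJet 0 (2 * m)| = evenJet m := by
  induction m with
  | zero => simp [gaussJet_zero_zero, evenJet]
  | succ m ih =>
    rw [mul_add, mul_one, gaussJet_zero_add_two, abs_mul, ih, evenJet_succ, abs_neg,
      abs_of_nonneg (by positivity)]
    push_cast; ring

theorem gaussJet_odd (m : ℕ) : gaussJet 0 (2 * m + 1) = 0 := by
  induction m with
  | zero => exact gaussJet_zero_one
  | succ m ih =>
    rw [show 2 * (m + 1) + 1 = (2 * m + 1) + 2 by ring, gaussJet_zero_add_two, ih, mul_zero]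

theorem abs_gaussJet_one_odd (m : ℕ) : |gaussJet 1 (2 * m + 1)| = oddJet m := by
  rw [gaussJet_one, show 2 * m + 1 + 1 = 2 * (m + 1) by ring, abs_div, abs_neg, abs_gaussJet_even,
    evenJet_succ_eq]
  simp

theorem gaussJet_one_even (m : ℕ) : gaussJet 1 (2 * m) = 0 := by
  rw [gaussJet_one, gaussJet_odd]; simp

/-- The margin `101 / 100` lets the Hessian entries of the test functions exceed `ε`. -/
theorem oddJet_le_pow (m : ℕ) : 101 / 100 * oddJet m ≤ (2 * (m + 1) : ℝ) ^ (m + 1) := by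
  induction m with
  | zero => norm_num [oddJet]
  | succ m ih =>
    have hm : (0 : ℝ) < m + 1 := by positivity
    have hB : (2 : ℝ) ≤ (1 + 1 / (m + 1)) ^ (m + 1) := by
      have := one_add_mul_le_pow (a := 1 / ((m : ℝ) + 1)) (by
        have : 0 < 1 / ((m : ℝ) + 1) := by positivity
        linarith) (m + 1)
      refine le_trans (le_of_eq ?_) this
      push_cast
      field_simp
      norm_num
    have hE : (2 * ((m : ℝ) + 1 + 1)) ^ (m + 1) =
        (2 * (m + 1) : ℝ) ^ (m + 1) * (1 + 1 / (m + 1)) ^ (m + 1) := by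
      rw [← mul_pow]
      congr 1
      field_simp
    rw [oddJet_succ]
    push_cast
    rw [pow_succ, hE]
    have hP : (0 : ℝ) ≤ (2 * (m + 1) : ℝ) ^ (m + 1) := by positivity
    calc 101 / 100 * ((4 * (m : ℝ) + 6) * oddJet m)
        = (4 * m + 6) * (101 / 100 * oddJet m) := by ring
      _ ≤ (4 * m + 6) * (2 * (m + 1) : ℝ) ^ (m + 1) := by gcongr
      _ ≤ (2 * (m + 1) : ℝ) ^ (m + 1) * 2 * (2 * (m + 1 + 1)) := by nlinarith
      _ ≤ _ := by gcongr

theorem one_add_pow_ge_quadratic {x : ℝ} (hx : 0 ≤ x) (n : ℕ) :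
    1 + n * x + n * (n - 1) / 2 * x ^ 2 ≤ (1 + x) ^ n := by
  induction n with
  | zero => simp
  | succ n ih =>
    rw [pow_succ]
    have h := mul_le_mul_of_nonneg_right ih (by linarith : 0 ≤ 1 + x)
    refine le_trans ?_ h
    have hn : (0 : ℝ) ≤ n * (n - 1) := by
      rcases n with _ | n
      · simp
      · push_cast; ring_nf; positivity
    have := mul_nonneg hn (pow_nonneg hx 3)
    push_cast
    nlinarith

/-- The ratio of the right side to the left one is smallest at `m = 3`, and from there on it grows,
because `2 + 1 / m ≤ (1 + 1 / m) ^ m`. -/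
theorem evenJet_le_pow (m : ℕ) : 101 / 100 * (m / 2 * evenJet m) ≤ (2 * m : ℝ) ^ m := by
  rcases Nat.lt_or_ge m 3 with h | h
  · interval_cases m <;> norm_num [evenJet, Finset.prod_range_succ]
  · induction m, h using Nat.le_induction with
    | base => norm_num [evenJet, Finset.prod_range_succ]
    | succ m hm ih =>
      have hm3 : (3 : ℝ) ≤ m := by exact_mod_cast hm
      have hm0 : (0 : ℝ) < m := by linarith
      have hB : 2 + 1 / (m : ℝ) ≤ (1 + 1 / m) ^ m := by
        refine le_trans ?_ (one_add_pow_ge_quadratic (by positivity) m)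
        rw [div_pow, ← sub_nonneg]
        have : 1 + (m : ℝ) * (1 / m) + m * (m - 1) / 2 * (1 ^ 2 / m ^ 2) - (2 + 1 / m) =
            (m - 3) / (2 * m) := by field_simp; ring
        rw [this]
        apply div_nonneg <;> linarith
      have hE : (2 * ((m : ℝ) + 1)) ^ m = (2 * m : ℝ) ^ m * (1 + 1 / m) ^ m := by
        rw [← mul_pow]
        congr 1
        field_simp
      rw [evenJet_succ]
      push_cast
      rw [pow_succ, hE]
      calc 101 / 100 * (((m : ℝ) + 1) / 2 * ((4 * m + 2) * evenJet m))
          = (2 + 1 / m) * (2 * (m + 1)) * (101 / 100 * (m / 2 * evenJet m)) := by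
            field_simp; ring
        _ ≤ (2 + 1 / m) * (2 * (m + 1)) * (2 * m : ℝ) ^ m := by gcongr
        _ = (2 * m : ℝ) ^ m * (2 + 1 / m) * (2 * (m + 1)) := by ring
        _ ≤ _ := by gcongr

/-! ### The test functions -/

/-- The index set of the upper triangle of a `d × d` matrix, diagonal included. -/
def upperPairs (d : ℕ) : Finset (Fin d × Fin d) := Finset.univ.filter fun q => q.1 ≤ q.2

theorem mem_upperPairs {d : ℕ} {q : Fin d × Fin d} : q ∈ upperPairs d ↔ q.1 ≤ q.2 := by
  simp [upperPairs]

/-- The exponent of the `i`-th variable in the monomial `y_j y_k`, where `q = (j, k)`. -/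
def pairExp {d : ℕ} (q : Fin d × Fin d) (i : Fin d) : ℕ :=
  (if i = q.1 then 1 else 0) + (if i = q.2 then 1 else 0)

/-- The weight that gives `y_j y_k` the mixed second derivative `1` for `j < k` and for `j = k`. -/
def pairWeight {d : ℕ} (q : Fin d × Fin d) : ℝ := if q.1 = q.2 then 1 / 2 else 1

/-- The function `w y_j y_k exp (-‖y‖²)` of `y = c x`, with `w = 1/2` for `j = k` and `w = 1`
otherwise, written as a product of functions of one variable. -/
def gaussBump {d : ℕ} (c : ℝ) (q : Fin d × Fin d) (x : EuclideanSpace ℝ (Fin d)) : ℝ :=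
  pairWeight q * ∏ i, gaussMonomial (pairExp q i) (c * x i)

/-- The combination of the bumps with coefficients `v` and constant term `C`. -/
def bumpSum {d : ℕ} (c C : ℝ) (v : Fin d × Fin d → ℝ) (x : EuclideanSpace ℝ (Fin d)) : ℝ :=
  C + ∑ q ∈ upperPairs d, v q * gaussBump c q x

theorem gaussBump_eq {d : ℕ} (c : ℝ) (q : Fin d × Fin d) (x : EuclideanSpace ℝ (Fin d)) :
    gaussBump c q x =
      pairWeight q * ((c * x q.1) * (c * x q.2) * Real.exp (-∑ i, (c * x i) ^ 2)) := by
  unfold gaussBump gaussMonomial pairExp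
  rw [Finset.prod_mul_distrib, ← Real.exp_sum, Finset.sum_neg_distrib]
  simp_rw [pow_add, Finset.prod_mul_distrib, pow_ite, pow_one, pow_zero]
  rw [Finset.prod_ite_eq' Finset.univ q.1, Finset.prod_ite_eq' Finset.univ q.2]
  simp

theorem analyticOnNhd_bumpSum {d : ℕ} (c C : ℝ) (v : Fin d × Fin d → ℝ) :
    AnalyticOnNhd ℝ (bumpSum c C v) Set.univ := by
  intro x _
  have hcoord : ∀ i : Fin d, AnalyticAt ℝ (fun x : EuclideanSpace ℝ (Fin d) => x i) x :=
    fun i => (EuclideanSpace.proj (𝕜 := ℝ) i).analyticAt x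
  have h1 : ∀ q : Fin d × Fin d, AnalyticAt ℝ (gaussBump c q) x := by
    intro q
    rw [show gaussBump c q = _ from funext (gaussBump_eq c q)]
    refine analyticAt_const.mul (((analyticAt_const.mul (hcoord _)).mul
      (analyticAt_const.mul (hcoord _))).mul (AnalyticAt.rexp (AnalyticAt.neg ?_)))
    exact Finset.analyticAt_fun_sum _ fun i _ => (analyticAt_const.mul (hcoord i)).pow 2
  exact analyticAt_const.add (Finset.analyticAt_fun_sum _ fun q _ => analyticAt_const.mul (h1 q))

/-- The derivative of order `α` at the origin of the combination, for `c = 1` and without the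
constant term. -/
def bumpJet {d : ℕ} (v : Fin d × Fin d → ℝ) (α : Fin d → ℕ) : ℝ :=
  ∑ q ∈ upperPairs d, v q * (pairWeight q * ∏ i, gaussJet (pairExp q i) (α i))

theorem foldr_partialDeriv_bumpSum {d : ℕ} (c C : ℝ) (v : Fin d × Fin d → ℝ) (L : List (Fin d))
    (hL : L ≠ []) :
    L.foldr partialDeriv (bumpSum c C v) 0 =
      c ^ (∑ k, L.count k) * bumpJet v (fun k => L.count k) := by
  have h1 : bumpSum c C v = fun x => C + ∑ q ∈ upperPairs d, (v q * pairWeight q) *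
      ∏ k, (fun y => gaussMonomial (pairExp q k) (c * y)) (x k) := by
    funext x
    simp only [bumpSum, gaussBump, mul_assoc]
  rw [h1, foldr_partialDeriv_sum_prod (upperPairs d) C (fun q => v q * pairWeight q)
    (fun q k y => gaussMonomial (pairExp q k) (c * y))]
  · simp only [if_neg hL, zero_add]
    rw [bumpJet, Finset.mul_sum]
    refine Finset.sum_congr rfl fun q _ => ?_
    have h2 : ∀ k, iteratedDeriv (L.count k) (fun y => gaussMonomial (pairExp q k) (c * y))
        ((0 : EuclideanSpace ℝ (Fin d)) k) = c ^ L.count k * gaussJet (pairExp q k) (L.count k) := by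
      intro k
      rw [iteratedDeriv_comp_const_mul (contDiff_gaussMonomial _)]
      simp [gaussJet]
    rw [Finset.prod_congr rfl fun k _ => h2 k, Finset.prod_mul_distrib, Finset.prod_pow_eq_pow_sum]
    ring
  · intro q k
    exact (contDiff_gaussMonomial _).comp (contDiff_const.mul contDiff_id)

theorem prod_gaussJet_diag {d : ℕ} (j : Fin d) (α : Fin d → ℕ) :
    ∏ i, gaussJet (pairExp (j, j) i) (α i) = -(α j / 2) * ∏ i, gaussJet 0 (α i) := by
  rw [← Finset.mul_prod_erase _ _ (Finset.mem_univ j),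
    ← Finset.mul_prod_erase Finset.univ (fun i => gaussJet 0 (α i)) (Finset.mem_univ j), ← mul_assoc]
  congr 1
  · simp [pairExp, gaussJet_two]
  · refine Finset.prod_congr rfl fun i hi => ?_
    simp [pairExp, Finset.ne_of_mem_erase hi]

/-- Off the diagonal, a product of jets vanishes unless the parity of the multi-index is that of
the monomial. -/
theorem eq_of_prod_gaussJet_ne_zero {d : ℕ} {q : Fin d × Fin d} (hq : q.1 ≠ q.2) {α : Fin d → ℕ}
    (h : ∏ i, gaussJet (pairExp q i) (α i) ≠ 0) (i : Fin d) :
    α i = 2 * (α i / 2) + pairExp q i := by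
  have hi := Finset.prod_ne_zero_iff.1 h i (Finset.mem_univ i)
  have he : pairExp q i = 0 ∨ pairExp q i = 1 := by
    unfold pairExp
    by_cases h1 : i = q.1
    · right; subst h1; simp [hq]
    · by_cases h2 : i = q.2 <;> simp [h1, h2]
      exact fun h => hq h.symm
  rcases Nat.even_or_odd' (α i) with ⟨m, hm | hm⟩
  · rcases he with he | he
    · omega
    · rw [he, hm, gaussJet_one_even] at hi
      exact absurd rfl hi
  · rcases he with he | he
    · rw [he, hm, gaussJet_odd] at hi
      exact absurd rfl hi
    · omega

theorem pairExp_eq_one_iff {d : ℕ} {q : Fin d × Fin d} (hq : q.1 ≠ q.2) (i : Fin d) :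
    pairExp q i = 1 ↔ i = q.1 ∨ i = q.2 := by
  unfold pairExp
  by_cases h1 : i = q.1
  · subst h1; simp [hq]
  · by_cases h2 : i = q.2 <;> simp [h1, h2]
    exact fun h => hq h.symm

theorem upperPairs_ext {d : ℕ} {q r : Fin d × Fin d} (hq : q ∈ upperPairs d)
    (hr : r ∈ upperPairs d) (hq' : q.1 ≠ q.2) (hr' : r.1 ≠ r.2)
    (h : ∀ i, i = q.1 ∨ i = q.2 ↔ i = r.1 ∨ i = r.2) : q = r := by
  rw [mem_upperPairs] at hq hr
  have h1 := (h q.1).1 (Or.inl rfl)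
  have h2 := (h q.2).1 (Or.inr rfl)
  have h3 := (h r.1).2 (Or.inl rfl)
  obtain ⟨a, b⟩ := q
  obtain ⟨a', b'⟩ := r
  simp only [ne_eq, Prod.mk.injEq, Fin.ext_iff, Fin.le_def] at *
  omega

/-- At most one off-diagonal bump has a nonzero derivative of order `α` at the origin, and then
no diagonal bump has. -/
theorem bumpJet_eq_of_ne_zero {d : ℕ} (v : Fin d × Fin d → ℝ) {q : Fin d × Fin d}
    (hq : q ∈ upperPairs d) (hq' : q.1 ≠ q.2) {α : Fin d → ℕ}
    (h : ∏ i, gaussJet (pairExp q i) (α i) ≠ 0) :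
    bumpJet v α = v q * ∏ i, gaussJet (pairExp q i) (α i) := by
  unfold bumpJet
  rw [Finset.sum_eq_single_of_mem q hq]
  · simp [pairWeight, hq']
  intro r hr hrq
  have hα := eq_of_prod_gaussJet_ne_zero hq' h
  suffices ∏ i, gaussJet (pairExp r i) (α i) = 0 by rw [this]; simp
  by_contra hne
  by_cases hr' : r.1 = r.2
  · have h1 : ∏ i, gaussJet 0 (α i) = 0 := by
      refine Finset.prod_eq_zero (Finset.mem_univ q.1) ?_
      rw [hα q.1, (pairExp_eq_one_iff hq' q.1).2 (Or.inl rfl), gaussJet_odd]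
    rw [show r = (r.1, r.1) from Prod.ext rfl hr'.symm, prod_gaussJet_diag, h1, mul_zero] at hne
    exact hne rfl
  · refine hrq (upperPairs_ext hr hq hr' hq' fun i => ?_)
    have hβ := eq_of_prod_gaussJet_ne_zero hr' hne
    rw [← pairExp_eq_one_iff hr', ← pairExp_eq_one_iff hq']
    have := hα i
    have := hβ i
    omega

theorem sum_upperPairs {d : ℕ} (F : Fin d × Fin d → ℝ) :
    ∑ q ∈ upperPairs d, F q = ∑ j, ∑ k, if j ≤ k then F (j, k) else 0 := by
  rw [upperPairs, Finset.sum_filter, ← Finset.univ_product_univ, Finset.sum_product]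

theorem sum_upperPairs_of_diag {d : ℕ} (F : Fin d × Fin d → ℝ)
    (h : ∀ q ∈ upperPairs d, q.1 ≠ q.2 → F q = 0) :
    ∑ q ∈ upperPairs d, F q = ∑ j, F (j, j) := by
  rw [sum_upperPairs]
  refine Finset.sum_congr rfl fun j _ => ?_
  rw [Finset.sum_eq_single_of_mem j (Finset.mem_univ j)]
  · simp
  · intro k _ hk
    split_ifs with hjk
    · exact h (j, k) (mem_upperPairs.2 hjk) (Ne.symm hk)
    · rfl

theorem two_mul_sum_upperPairs {d : ℕ} (F : Fin d × Fin d → ℝ) (h : ∀ j k, F (j, k) = F (k, j)) :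
    2 * ∑ q ∈ upperPairs d, F q = ∑ j, ∑ k, F (j, k) + ∑ j, F (j, j) := by
  have h1 : ∑ q ∈ upperPairs d, F q = ∑ j, ∑ k, if k ≤ j then F (j, k) else 0 := by
    rw [sum_upperPairs, Finset.sum_comm]
    simp_rw [h]
  rw [two_mul]
  nth_rewrite 1 [sum_upperPairs]
  rw [h1, ← Finset.sum_add_distrib, ← Finset.sum_add_distrib]
  refine Finset.sum_congr rfl fun j _ => ?_
  rw [← Finset.sum_add_distrib]
  have h2 : F (j, j) = ∑ k, if k = j then F (j, k) else 0 := by simp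
  rw [h2, ← Finset.sum_add_distrib]
  refine Finset.sum_congr rfl fun k _ => ?_
  rcases lt_trichotomy j k with hjk | hjk | hjk
  · simp [hjk.le, hjk.not_ge, hjk.ne']
  · simp [hjk]
  · simp [hjk.le, hjk.not_ge, hjk.ne]

/-- If no off-diagonal bump contributes, the diagonal ones add up to a multiple of a single
product of derivatives of Gaussians. -/
theorem bumpJet_eq_of_offDiag_eq_zero {d : ℕ} (v : Fin d × Fin d → ℝ) {α : Fin d → ℕ}
    (h : ∀ q ∈ upperPairs d, q.1 ≠ q.2 → ∏ i, gaussJet (pairExp q i) (α i) = 0) :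
    bumpJet v α = -(∑ j, v (j, j) * α j) / 4 * ∏ i, gaussJet 0 (α i) := by
  unfold bumpJet
  rw [sum_upperPairs_of_diag _ fun q hq hq' => by rw [h q hq hq']; simp, neg_div, neg_mul,
    ← mul_neg, Finset.sum_div, Finset.sum_mul]
  refine Finset.sum_congr rfl fun j _ => ?_
  rw [prod_gaussJet_diag]
  simp only [pairWeight, if_true]
  ring

theorem rpow_half_two_mul (m : ℕ) :
    ((2 * m : ℕ) : ℝ) ^ (((2 * m : ℕ) : ℝ) / 2) = (2 * m : ℝ) ^ m := by
  rw [show (((2 * m : ℕ) : ℝ) / 2) = (m : ℝ) by push_cast; ring, Real.rpow_natCast]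
  push_cast
  ring

theorem sum_pairExp {d : ℕ} (q : Fin d × Fin d) : ∑ i, pairExp q i = 2 := by
  simp [pairExp, Finset.sum_add_distrib]

theorem abs_bumpJet_le {d : ℕ} {v : Fin d × Fin d → ℝ} (hv : ∀ q, |v q| ≤ 101 / 100)
    (α : Fin d → ℕ) :
    |bumpJet v α| ≤ ((∑ i, α i : ℕ) : ℝ) ^ (((∑ i, α i : ℕ) : ℝ) / 2) := by
  by_cases h : ∃ q ∈ upperPairs d, q.1 ≠ q.2 ∧ ∏ i, gaussJet (pairExp q i) (α i) ≠ 0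
  · obtain ⟨q, hq, hq', hne⟩ := h
    have hα := eq_of_prod_gaussJet_ne_zero hq' hne
    have hsum : ∑ i, α i = 2 * (∑ i, α i / 2 + 1) := by
      rw [Finset.sum_congr rfl fun i _ => hα i, Finset.sum_add_distrib, sum_pairExp,
        ← Finset.mul_sum]
      ring
    have hprod : |∏ i, gaussJet (pairExp q i) (α i)| ≤ oddJet (∑ i, α i / 2) := by
      rw [Finset.abs_prod]
      refine le_trans (Finset.prod_le_prod (fun _ _ => abs_nonneg _) fun i _ => ?_)
        (prod_oddJet_le _ _)
      rcases Nat.even_or_odd' (α i) with ⟨m, hm | hm⟩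
      · have h0 : pairExp q i = 0 := by
          have := hα i
          omega
        rw [h0, hm, abs_gaussJet_even, Nat.mul_div_cancel_left _ two_pos]
        exact evenJet_le_oddJet m
      · have h1 : pairExp q i = 1 := by
          have := hα i
          omega
        rw [h1, hm, abs_gaussJet_one_odd, show (2 * m + 1) / 2 = m by omega]
    rw [bumpJet_eq_of_ne_zero v hq hq' hne, abs_mul, hsum, rpow_half_two_mul]
    have hle := (mul_le_mul (hv q) hprod (abs_nonneg _) (by norm_num)).trans
      (oddJet_le_pow (∑ i, α i / 2))
    exact_mod_cast hle
  · push Not at h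
    rw [bumpJet_eq_of_offDiag_eq_zero v h]
    by_cases heven : ∀ i, Even (α i)
    · choose β hβ using fun i => (heven i).exists_two_nsmul
      simp only [smul_eq_mul] at hβ
      obtain rfl : α = fun i => 2 * β i := funext hβ
      simp only [← Finset.mul_sum]
      rw [rpow_half_two_mul, abs_mul, Finset.abs_prod]
      simp_rw [abs_gaussJet_even]
      refine le_trans ?_ (evenJet_le_pow _)
      rw [← mul_assoc]
      refine mul_le_mul ?_ (prod_evenJet_le _ _) (Finset.prod_nonneg fun _ _ => evenJet_nonneg _)
        (by positivity)
      rw [abs_div, abs_neg, abs_of_pos (by norm_num : (0 : ℝ) < 4)]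
      have h1 : |∑ j, v (j, j) * ((2 * β j : ℕ) : ℝ)| ≤ ∑ j, 101 / 100 * (2 * (β j : ℝ)) := by
        refine (Finset.abs_sum_le_sum_abs _ _).trans (Finset.sum_le_sum fun j _ => ?_)
        rw [abs_mul, Nat.abs_cast]
        push_cast
        exact mul_le_mul_of_nonneg_right (hv _) (by positivity)
      rw [← Finset.mul_sum, ← Finset.mul_sum] at h1
      push_cast at h1 ⊢
      linarith
    · push Not at heven
      obtain ⟨i, hi⟩ := heven
      obtain ⟨m, hm⟩ := Nat.not_even_iff_odd.1 hi
      rw [Finset.prod_eq_zero (Finset.mem_univ i) (by rw [hm, gaussJet_odd]), mul_zero, abs_zero]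
      positivity

theorem smoothClass_bumpSum {d : ℕ} {c : ℝ} (hc : 0 ≤ c) (C : ℝ) {v : Fin d × Fin d → ℝ}
    (hv : ∀ q, |v q| ≤ 101 / 100) : SmoothClass d c (bumpSum c C v) := by
  refine ⟨analyticOnNhd_bumpSum c C v, fun t ht α hα => ?_⟩
  rw [multiDeriv_eq_foldr, foldr_partialDeriv_bumpSum]
  · simp_rw [count_directions]
    rw [abs_mul, abs_of_nonneg (pow_nonneg hc _), ← hα]
    exact mul_le_mul_of_nonneg_left (abs_bumpJet_le hv α) (pow_nonneg hc _)
  · intro h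
    have : ∑ k, (directions α).count k = 0 := by simp [h]
    simp_rw [count_directions] at this
    omega

theorem hessianMatrix_bumpSum {d : ℕ} (c C : ℝ) (v : Fin d × Fin d → ℝ) {j k : Fin d}
    (hjk : j ≤ k) : hessianMatrix (bumpSum c C v) 0 j k = c ^ 2 * v (j, k) := by
  have h1 : hessianMatrix (bumpSum c C v) 0 j k =
      [j, k].foldr partialDeriv (bumpSum c C v) 0 := rfl
  have h2 : (fun i => [j, k].count i) = pairExp (j, k) := by
    funext i
    simp only [List.count_cons, List.count_nil, pairExp, beq_iff_eq, zero_add]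
    rw [add_comm]
    simp only [eq_comm]
  have h3 : ∀ i, [j, k].count i = pairExp (j, k) i := fun i => congrFun h2 i
  rw [h1, foldr_partialDeriv_bumpSum _ _ _ _ (by simp)]
  simp_rw [h3]
  rw [sum_pairExp]
  congr 1
  have h20 : gaussJet 0 2 = -2 := by
    have := gaussJet_zero_add_two 0
    rw [gaussJet_zero_zero] at this
    simpa using this
  rcases hjk.eq_or_lt with rfl | hlt
  · rw [bumpJet_eq_of_offDiag_eq_zero]
    · have h4 : ∀ i, pairExp (j, j) i = if i = j then 2 else 0 := by
        intro i
        by_cases hi : i = j <;> simp [pairExp, hi]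
      simp only [h4]
      rw [Finset.prod_eq_single j (by intro i _ hi; simp [hi, gaussJet_zero_zero]) (by simp)]
      simp [h20]
      ring
    · intro q _ hq
      by_contra hne
      have h5 := eq_of_prod_gaussJet_ne_zero hq hne q.1
      rw [(pairExp_eq_one_iff hq q.1).2 (Or.inl rfl)] at h5
      simp only [pairExp] at h5
      split_ifs at h5 <;> omega
  · have h6 : ∏ i, gaussJet (pairExp (j, k) i) (pairExp (j, k) i) = 1 := by
      refine Finset.prod_eq_one fun i _ => ?_
      have h11 : gaussJet 1 1 = 1 := by rw [gaussJet_one, h20]; norm_num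
      unfold pairExp
      by_cases hi : i = j
      · have : i ≠ k := hi ▸ hlt.ne
        simp [hi, hlt.ne, h11]
      · by_cases hi' : i = k <;> simp [hi, hi', h11, gaussJet_zero_zero, hlt.ne']
    rw [bumpJet_eq_of_ne_zero v (mem_upperPairs.2 hlt.le) hlt.ne (by rw [h6]; simp), h6, mul_one]

/-! ### The hybrid argument -/

namespace PhaseQueryAlgorithm

variable {d : ℕ} {G : Finset (EuclideanSpace ℝ (Fin d))}

theorem norm_query_sub_query {w : ℕ} (s : Fin w → SignType) (f : EuclideanSpace ℝ (Fin d) → ℝ)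
    (φ ψ : EuclideanSpace ℂ (G × Fin w)) : ‖query s f φ - query s f ψ‖ = ‖φ - ψ‖ := by
  rw [EuclideanSpace.norm_eq, EuclideanSpace.norm_eq]
  congr 1
  refine Finset.sum_congr rfl fun p _ => ?_
  simp only [query, PiLp.sub_apply]
  rw [← mul_sub, norm_mul, mul_comm Complex.I, Complex.norm_exp_ofReal_mul_I, one_mul]

theorem norm_query {w : ℕ} (s : Fin w → SignType) (f : EuclideanSpace ℝ (Fin d) → ℝ)
    (ψ : EuclideanSpace ℂ (G × Fin w)) : ‖query s f ψ‖ = ‖ψ‖ := by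
  have h := norm_query_sub_query s f ψ 0
  have h0 : query s f (0 : EuclideanSpace ℂ (G × Fin w)) = 0 := by
    ext p
    simp [query]
  rwa [h0, sub_zero, sub_zero] at h

theorem norm_state (A : PhaseQueryAlgorithm G) (f : EuclideanSpace ℝ (Fin d) → ℝ) (t : ℕ) :
    ‖A.state f t‖ = 1 := by
  induction t with
  | zero => exact A.norm_init
  | succ t ih => rw [state, LinearIsometryEquiv.norm_map, norm_query, ih]

theorem norm_exp_I_mul_sub_le (a b : ℝ) :
    ‖Complex.exp (Complex.I * (a : ℂ)) - Complex.exp (Complex.I * (b : ℂ))‖ ≤ |a - b| := by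
  have h : Complex.exp (Complex.I * (a : ℂ)) - Complex.exp (Complex.I * (b : ℂ)) =
      Complex.exp (b * Complex.I) * (Complex.exp (Complex.I * ((a - b : ℝ) : ℂ)) - 1) := by
    rw [mul_sub, ← Complex.exp_add, mul_one]
    congr 2
    · push_cast; ring
    · ring
  rw [h, norm_mul, Complex.norm_exp_ofReal_mul_I, one_mul]
  exact Real.norm_exp_I_mul_ofReal_sub_one_le

theorem norm_sq_query_sub_le {w : ℕ} (s : Fin w → SignType)
    (f g : EuclideanSpace ℝ (Fin d) → ℝ) (ψ : EuclideanSpace ℂ (G × Fin w)) :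
    ‖query s f ψ - query s g ψ‖ ^ 2 ≤
      ∑ p : G × Fin w, (f (p.1 : EuclideanSpace ℝ (Fin d)) - g p.1) ^ 2 * ‖ψ p‖ ^ 2 := by
  rw [EuclideanSpace.norm_sq_eq]
  refine Finset.sum_le_sum fun p _ => ?_
  simp only [query, PiLp.sub_apply]
  rw [← sub_mul, norm_mul, mul_pow]
  refine mul_le_mul_of_nonneg_right ?_ (sq_nonneg _)
  rw [← sq_abs (f _ - g _)]
  refine pow_le_pow_left₀ (norm_nonneg _) ((norm_exp_I_mul_sub_le _ _).trans ?_) 2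
  rw [← mul_sub, abs_mul]
  refine mul_le_of_le_one_left (abs_nonneg _) ?_
  cases s p.2 <;> simp

theorem norm_state_sub_le (A : PhaseQueryAlgorithm G) (f g : EuclideanSpace ℝ (Fin d) → ℝ)
    (t : ℕ) : ‖A.state f t - A.state g t‖ ≤ ∑ r ∈ Finset.range t,
      ‖query (A.mode r) f (A.state g r) - query (A.mode r) g (A.state g r)‖ := by
  induction t with
  | zero => simp [state]
  | succ t ih =>
    rw [Finset.sum_range_succ, state, state, ← map_sub, LinearIsometryEquiv.norm_map]
    refine (norm_sub_le_norm_sub_add_norm_sub _ (query (A.mode t) f (A.state g t)) _).trans ?_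
    rw [norm_query_sub_query]
    gcongr

/-- Averaged over the family, `t` queries move the final states away from the reference one by at
most `t` times the root mean square of the phase differences at the worst point. -/
theorem sum_norm_sq_state_sub_le {κ : Type*} (A : PhaseQueryAlgorithm G) (P : Finset κ)
    (f : κ → EuclideanSpace ℝ (Fin d) → ℝ) (g : EuclideanSpace ℝ (Fin d) → ℝ) {B : ℝ}
    (hB : ∀ x, ∑ q ∈ P, (f q x - g x) ^ 2 ≤ B) (t : ℕ) :
    ∑ q ∈ P, ‖A.state (f q) t - A.state g t‖ ^ 2 ≤ t ^ 2 * B := by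
  calc ∑ q ∈ P, ‖A.state (f q) t - A.state g t‖ ^ 2
      ≤ ∑ q ∈ P, t * ∑ r ∈ Finset.range t,
          ‖query (A.mode r) (f q) (A.state g r) - query (A.mode r) g (A.state g r)‖ ^ 2 := by
        refine Finset.sum_le_sum fun q _ => ?_
        refine (pow_le_pow_left₀ (norm_nonneg _) (A.norm_state_sub_le (f q) g t) 2).trans ?_
        simpa using sq_sum_le_card_mul_sum_sq (s := Finset.range t) (f := fun r =>
          ‖query (A.mode r) (f q) (A.state g r) - query (A.mode r) g (A.state g r)‖)
    _ = t * ∑ r ∈ Finset.range t, ∑ q ∈ P,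
          ‖query (A.mode r) (f q) (A.state g r) - query (A.mode r) g (A.state g r)‖ ^ 2 := by
        rw [← Finset.mul_sum, Finset.sum_comm]
    _ ≤ t * ∑ r ∈ Finset.range t, B := by
        gcongr with r _
        calc _ ≤ ∑ q ∈ P, ∑ p : G × Fin A.workDim,
              (f q (p.1 : EuclideanSpace ℝ (Fin d)) - g p.1) ^ 2 * ‖A.state g r p‖ ^ 2 :=
            Finset.sum_le_sum fun q _ => norm_sq_query_sub_le _ _ _ _
          _ = ∑ p : G × Fin A.workDim, (∑ q ∈ P,
              (f q (p.1 : EuclideanSpace ℝ (Fin d)) - g p.1) ^ 2) * ‖A.state g r p‖ ^ 2 := by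
            rw [Finset.sum_comm]
            simp_rw [Finset.sum_mul]
          _ ≤ ∑ p : G × Fin A.workDim, B * ‖A.state g r p‖ ^ 2 := by
            gcongr
            exact hB _
          _ = B := by
            rw [← Finset.mul_sum, ← EuclideanSpace.norm_sq_eq, A.norm_state]
            ring
    _ = t ^ 2 * B := by
        simp
        ring

theorem mul_norm_sq_le_norm_sub_sq {lam : ℝ} (hl : 0 < lam) (z u : ℂ) :
    (1 - lam) * ‖z‖ ^ 2 ≤ ‖z - u‖ ^ 2 + (1 / lam - 1) * ‖u‖ ^ 2 := by
  have h1 : (‖z‖ - ‖u‖) ^ 2 ≤ ‖z - u‖ ^ 2 := by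
    rw [← sq_abs]
    exact pow_le_pow_left₀ (abs_nonneg _) (abs_norm_sub_norm_le z u) 2
  have h2 : 0 ≤ (lam * ‖z‖ - ‖u‖) ^ 2 / lam := by positivity
  have h3 : (lam * ‖z‖ - ‖u‖) ^ 2 / lam = lam * ‖z‖ ^ 2 - 2 * ‖z‖ * ‖u‖ + 1 / lam * ‖u‖ ^ 2 := by
    field_simp
    ring
  nlinarith

/-- If the answers to the functions of a finite family and to a reference function exclude each
other, then an algorithm that succeeds on all of them has to tell the family apart from the
reference, at the price of the phase differences. The parameter `lam` is the one in
`2 a b ≤ lam a² + b² / lam`. -/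
theorem card_mul_le_of_successProb {κ : Type*} (A : PhaseQueryAlgorithm G) (P : Finset κ)
    (f : κ → EuclideanSpace ℝ (Fin d) → ℝ) (g : EuclideanSpace ℝ (Fin d) → ℝ) {B ε lam : ℝ}
    (hB : ∀ x, ∑ q ∈ P, (f q x - g x) ^ 2 ≤ B) (hl : 0 < lam) (hl1 : lam ≤ 1)
    (hfg : ∀ M, IsMaxNormApprox ε M (hessianMatrix g 0) →
      ∀ q ∈ P, ¬ IsMaxNormApprox ε M (hessianMatrix (f q) 0))
    (hff : ∀ M, ∀ q ∈ P, ∀ r ∈ P, IsMaxNormApprox ε M (hessianMatrix (f q) 0) →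
      IsMaxNormApprox ε M (hessianMatrix (f r) 0) → q = r)
    (hf : ∀ q ∈ P, 2 / 3 ≤ A.successProb (f q) ε) (hg : 2 / 3 ≤ A.successProb g ε) :
    P.card * ((1 - lam) * (2 / 3)) ≤
      (A.numQueries : ℝ) ^ 2 * B + (1 / lam - 1) * (1 / 3) := by
  classical
  set T := A.numQueries
  -- The probability that the run on the reference function returns an answer valid for `f q`.
  set pr : κ → ℝ := fun q => ∑ p : G × Fin A.workDim,
    if IsMaxNormApprox ε (A.output p) (hessianMatrix (f q) 0) then ‖A.state g T p‖ ^ 2 else 0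
    with hpr
  have h1 : ∀ q ∈ P, (1 - lam) * (2 / 3) ≤
      ‖A.state (f q) T - A.state g T‖ ^ 2 + (1 / lam - 1) * pr q := by
    intro q hq
    calc (1 - lam) * (2 / 3) ≤ (1 - lam) * A.successProb (f q) ε :=
          mul_le_mul_of_nonneg_left (hf q hq) (by linarith)
      _ ≤ _ := by
        rw [successProb, EuclideanSpace.norm_sq_eq, Finset.mul_sum, hpr, Finset.mul_sum,
          ← Finset.sum_add_distrib]
        refine Finset.sum_le_sum fun p _ => ?_
        split_ifs
        · exact mul_norm_sq_le_norm_sub_sq hl _ _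
        · simp
  have h2 : ∑ q ∈ P, pr q ≤ 1 / 3 := by
    have h3 : ∑ q ∈ P, pr q + A.successProb g ε ≤ 1 := by
      rw [hpr, successProb, Finset.sum_comm, ← Finset.sum_add_distrib]
      have hn : ∑ p, ‖A.state g T p‖ ^ 2 = 1 := by
        rw [← EuclideanSpace.norm_sq_eq, A.norm_state, one_pow]
      rw [← hn]
      refine Finset.sum_le_sum fun p _ => ?_
      by_cases h0 : IsMaxNormApprox ε (A.output p) (hessianMatrix g 0)
      · rw [if_pos h0, Finset.sum_eq_zero, zero_add]
        intro q hq
        rw [if_neg (hfg _ h0 q hq)]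
      · rw [if_neg h0, add_zero]
        by_cases h4 : ∃ q ∈ P, IsMaxNormApprox ε (A.output p) (hessianMatrix (f q) 0)
        · obtain ⟨q, hq, hap⟩ := h4
          rw [Finset.sum_eq_single_of_mem q hq, if_pos hap]
          intro r hr hrq
          rw [if_neg fun har => hrq (hff _ r hr q hq har hap)]
        · push Not at h4
          rw [Finset.sum_eq_zero fun q hq => if_neg (h4 q hq)]
          positivity
    linarith
  have h5 := Finset.sum_le_sum h1
  rw [Finset.sum_const, nsmul_eq_mul, Finset.sum_add_distrib, ← Finset.mul_sum] at h5
  have h6 := A.sum_norm_sq_state_sub_le P f g hB T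
  have h7 : 0 ≤ 1 / lam - 1 := by
    rw [sub_nonneg, le_div_iff₀ hl]
    linarith
  have h8 := mul_le_mul_of_nonneg_left h2 h7
  linarith

end PhaseQueryAlgorithm

/-! ### The lower bound -/

theorem card_upperPairs (d : ℕ) : ((upperPairs d).card : ℝ) = d * (d + 1) / 2 := by
  have h := two_mul_sum_upperPairs (d := d) (fun _ => 1) fun _ _ => rfl
  simp at h
  linarith

/-- The offset subtracted from the bumps. Only the diagonal ones, which are nonnegative, get one:
a constant shift changes no derivative, but reduces the size of the function. -/
def bumpOffset {d : ℕ} (q : Fin d × Fin d) : ℝ :=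
  if q.1 = q.2 then 1 / (2 * Real.exp 1) / (d + 1) else 0

theorem mul_exp_neg_le (r : ℝ) : r * Real.exp (-r) ≤ 1 / Real.exp 1 := by
  have h1 : r ≤ Real.exp (r - 1) := by linarith [Real.add_one_le_exp (r - 1)]
  calc r * Real.exp (-r) ≤ Real.exp (r - 1) * Real.exp (-r) := by gcongr
    _ = 1 / Real.exp 1 := by
      rw [← Real.exp_add, one_div, ← Real.exp_neg]
      congr 1
      ring

theorem quadratic_offset_le {d s σ : ℝ} (hd : 1 ≤ d) (hs : 0 ≤ s) (hsσ : s ≤ σ) :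
    2 * s ^ 2 - s ^ 2 / d - 2 * (σ / (d + 1)) * s + d * (σ / (d + 1)) ^ 2 ≤
      σ ^ 2 * ((2 * d ^ 4 + 2 * d ^ 3 - 2 * d ^ 2 - d) / (d ^ 2 * (d + 1) ^ 2)) := by
  have hd0 : 0 < d := by linarith
  rw [← sub_nonneg]
  have h1 : σ ^ 2 * ((2 * d ^ 4 + 2 * d ^ 3 - 2 * d ^ 2 - d) / (d ^ 2 * (d + 1) ^ 2)) -
      (2 * s ^ 2 - s ^ 2 / d - 2 * (σ / (d + 1)) * s + d * (σ / (d + 1)) ^ 2) =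
      (σ - s) * (((2 * d - 1) * (d + 1) - 2 * d) * σ + (2 * d - 1) * (d + 1) * s) /
        (d * (d + 1)) := by
    field_simp
    ring
  rw [h1]
  have h2 : 0 ≤ (2 * d - 1) * (d + 1) - 2 * d := by nlinarith
  have h3 : 0 ≤ (2 * d - 1) * (d + 1) := by nlinarith
  have h4 := mul_nonneg h2 (hs.trans hsσ)
  have h5 := mul_nonneg h3 hs
  exact div_nonneg (mul_nonneg (by linarith) (by linarith)) (by positivity)

/-- The squares of the bumps at a point add up to a bounded quantity, which does not grow with the
dimension because the off-diagonal ones add up to at most `(‖y‖² exp (-‖y‖²))² / 2`. -/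
theorem sum_sq_gaussBump_sub_le {d : ℕ} (hd : 1 ≤ d) (c : ℝ) (x : EuclideanSpace ℝ (Fin d)) :
    ∑ q ∈ upperPairs d, (gaussBump c q x - bumpOffset q) ^ 2 ≤ (1 / (2 * Real.exp 1)) ^ 2 *
      ((2 * d ^ 4 + 2 * d ^ 3 - 2 * d ^ 2 - d) / (d ^ 2 * (d + 1) ^ 2)) := by
  set E := Real.exp (-∑ i, (c * x i) ^ 2) with hE
  set τ : ℝ := 1 / (2 * Real.exp 1) / (d + 1) with hτ
  set u : Fin d → ℝ := fun i => (c * x i) ^ 2 * E / 2 with hu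
  set s := ∑ i, u i with hs
  have h1 : ∀ q : Fin d × Fin d, (gaussBump c q x - bumpOffset q) ^ 2 = 4 * (u q.1 * u q.2) +
      (if q.1 = q.2 then (u q.1 - τ) ^ 2 - 4 * u q.1 ^ 2 else 0) := by
    rintro ⟨j, k⟩
    rw [gaussBump_eq, ← hE, pairWeight, bumpOffset, ← hτ]
    by_cases hjk : j = k
    · subst hjk
      simp only [if_true, hu]
      ring
    · simp only [if_neg hjk, hu]
      ring
  have hd' : (1 : ℝ) ≤ d := by exact_mod_cast hd
  have h2 := two_mul_sum_upperPairs (fun q : Fin d × Fin d => 4 * (u q.1 * u q.2))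
    fun j k => by ring
  have h3 : ∑ q ∈ upperPairs d,
      (if q.1 = q.2 then (u q.1 - τ) ^ 2 - 4 * u q.1 ^ 2 else 0) =
      ∑ j, ((u j - τ) ^ 2 - 4 * u j ^ 2) := by
    rw [sum_upperPairs_of_diag]
    · simp
    · intro q _ hq
      rw [if_neg hq]
  have h4 : ∑ j, ∑ k, 4 * (u j * u k) = 4 * s ^ 2 := by
    rw [sq, hs, Finset.sum_mul_sum, Finset.mul_sum]
    simp_rw [Finset.mul_sum]
  have h5 : ∑ j, 4 * (u j * u j) = 4 * ∑ j, u j ^ 2 := by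
    rw [Finset.mul_sum]
    exact Finset.sum_congr rfl fun j _ => by ring
  have h6 : ∑ j, ((u j - τ) ^ 2 - 4 * u j ^ 2) =
      -3 * ∑ j, u j ^ 2 - 2 * τ * s + d * τ ^ 2 := by
    have : ∀ j, (u j - τ) ^ 2 - 4 * u j ^ 2 = -3 * u j ^ 2 - 2 * τ * u j + τ ^ 2 :=
      fun j => by ring
    simp_rw [this]
    rw [Finset.sum_add_distrib, Finset.sum_sub_distrib, ← Finset.mul_sum, ← Finset.mul_sum]
    simp [hs]
  have h7 : s ^ 2 / d ≤ ∑ j, u j ^ 2 := by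
    rw [div_le_iff₀ (by linarith), mul_comm]
    simpa using sq_sum_le_card_mul_sum_sq (s := (Finset.univ : Finset (Fin d))) (f := u)
  have h8 : 0 ≤ s := Finset.sum_nonneg fun i _ => by positivity
  have h9 : s ≤ 1 / (2 * Real.exp 1) := by
    have h10 : s = (∑ i, (c * x i) ^ 2) * E / 2 := by
      rw [hs, Finset.sum_mul, Finset.sum_div]
    have h11 := mul_exp_neg_le (∑ i, (c * x i) ^ 2)
    rw [← hE] at h11
    rw [h10]
    calc _ ≤ 1 / Real.exp 1 / 2 := by linarith
      _ = _ := by rw [div_div, mul_comm]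
  have h12 := quadratic_offset_le hd' h8 h9
  rw [← hτ] at h12
  simp_rw [h1]
  rw [Finset.sum_add_distrib, h3, h6]
  rw [h4, h5] at h2
  linarith

theorem bumpSum_add_offset_sub {d : ℕ} (c b : ℝ) {q : Fin d × Fin d} (hq : q ∈ upperPairs d)
    (x : EuclideanSpace ℝ (Fin d)) :
    bumpSum c (-(2 * b * bumpOffset q)) (fun r => if r = q then b else -b) x -
      bumpSum c 0 (fun _ => -b) x = 2 * b * (gaussBump c q x - bumpOffset q) := by
  unfold bumpSum
  have h : ∑ r ∈ upperPairs d, (if r = q then b else -b) * gaussBump c r x =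
      ∑ r ∈ upperPairs d, -b * gaussBump c r x + 2 * b * gaussBump c q x := by
    rw [← Finset.add_sum_erase _ _ hq,
      ← Finset.add_sum_erase _ (fun r => -b * gaussBump c r x) hq, if_pos rfl]
    have : ∑ r ∈ (upperPairs d).erase q, (if r = q then b else -b) * gaussBump c r x =
        ∑ r ∈ (upperPairs d).erase q, -b * gaussBump c r x :=
      Finset.sum_congr rfl fun r hr => by rw [if_neg (Finset.ne_of_mem_erase hr)]
    rw [this]
    ring
  rw [h]
  ring

end

theorem proposition6p6 (d : ℕ) (hd : 1 ≤ d) (ε c : ℝ) (hε : 0 < ε) (hc : 1 ≤ c) (hεc : ε ≤ c)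
    (G : Finset (EuclideanSpace ℝ (Fin d))) (T : ℕ)
    (A : PhaseQueryAlgorithm G) (hT : A.numQueries = T)
    (hA : ∀ f : EuclideanSpace ℝ (Fin d) → ℝ, SmoothClass d c f → 2 / 3 ≤ A.successProb f ε) :
    c * d / ε < T := by
  have hc0 : 0 < c := by linarith
  have hd1 : (1 : ℝ) ≤ d := by exact_mod_cast hd
  -- The Hessian entries are `± c² b = ± 1.01 ε`: of different signs by more than twice `ε`.
  set b : ℝ := 101 / 100 * ε / c ^ 2 with hb
  have hcb : c ^ 2 * b = 101 / 100 * ε := by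
    rw [hb]
    field_simp
  have hb0 : 0 < b := by positivity
  have hb1 : b ≤ 101 / 100 := by
    rw [hb, div_le_iff₀ (by positivity)]
    nlinarith
  set g := bumpSum (d := d) c 0 fun _ => -b with hg
  set f : Fin d × Fin d → EuclideanSpace ℝ (Fin d) → ℝ := fun q =>
    bumpSum c (-(2 * b * bumpOffset q)) fun r => if r = q then b else -b with hf
  have hgs : 2 / 3 ≤ A.successProb g ε :=
    hA _ (smoothClass_bumpSum hc0.le _ fun q => by rw [abs_neg, abs_of_pos hb0]; exact hb1)
  have hfs : ∀ q ∈ upperPairs d, 2 / 3 ≤ A.successProb (f q) ε := fun q _ =>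
    hA _ (smoothClass_bumpSum hc0.le _ fun r => by
      split_ifs
      · rw [abs_of_pos hb0]; exact hb1
      · rw [abs_neg, abs_of_pos hb0]; exact hb1)
  -- The sign of the upper triangular entries of the answer reveals the function.
  have hpos : ∀ M q, q ∈ upperPairs d → IsMaxNormApprox ε M (hessianMatrix (f q) 0) →
      0 < M q.1 q.2 := by
    intro M q hq h
    have h1 := (abs_le.1 (h q.1 q.2)).1
    rw [hf, hessianMatrix_bumpSum _ _ _ (mem_upperPairs.1 hq), if_pos rfl, hcb] at h1
    linarith
  have hneg : ∀ M q r, r ∈ upperPairs d → r ≠ q →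
      IsMaxNormApprox ε M (hessianMatrix (f q) 0) → M r.1 r.2 < 0 := by
    intro M q r hr hrq h
    have h1 := (abs_le.1 (h r.1 r.2)).2
    rw [hf, hessianMatrix_bumpSum _ _ _ (mem_upperPairs.1 hr), if_neg hrq, mul_neg, hcb] at h1
    linarith
  have hneg' : ∀ M r, r ∈ upperPairs d → IsMaxNormApprox ε M (hessianMatrix g 0) →
      M r.1 r.2 < 0 := by
    intro M r hr h
    have h1 := (abs_le.1 (h r.1 r.2)).2
    rw [hg, hessianMatrix_bumpSum _ _ _ (mem_upperPairs.1 hr), mul_neg, hcb] at h1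
    linarith
  set R : ℝ := 2 * d ^ 4 + 2 * d ^ 3 - 2 * d ^ 2 - d with hR
  have hB : ∀ x, ∑ q ∈ upperPairs d, (f q x - g x) ^ 2 ≤
      (2 * b) ^ 2 * ((1 / (2 * Real.exp 1)) ^ 2 * (R / (d ^ 2 * (d + 1) ^ 2))) := by
    intro x
    calc _ = ∑ q ∈ upperPairs d, (2 * b) ^ 2 * (gaussBump c q x - bumpOffset q) ^ 2 :=
          Finset.sum_congr rfl fun q hq => by rw [hf, hg, bumpSum_add_offset_sub c b hq, mul_pow]
      _ ≤ _ := by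
        rw [← Finset.mul_sum]
        exact mul_le_mul_of_nonneg_left (sum_sq_gaussBump_sub_le hd c x) (sq_nonneg _)
  -- The best `lam` is `b / a`, where `a² = 2/3` and `b²` is the probability `1/3` spread evenly over
  -- the `d (d + 1) / 2` functions. This is `1 / √(d (d + 1))`, for which `2 / (2 d + 1)` is a
  -- rational substitute.
  have key := A.card_mul_le_of_successProb (upperPairs d) f g (lam := 2 / (2 * d + 1)) hB
    (by positivity) (by rw [div_le_one (by positivity)]; linarith)
    (fun M h q hq h' => absurd (hpos M q hq h') (hneg' M q hq h).not_gt)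
    (fun M q hq r hr h h' => by
      by_contra hqr
      exact absurd (hpos M q hq h) (hneg M r q hq hqr h').not_gt) hfs hgs
  rw [card_upperPairs, hT] at key
  by_contra hlt
  push Not at hlt
  have hTd : ((T : ℝ) * b) ^ 2 ≤ (101 / 100 * d) ^ 2 := by
    refine pow_le_pow_left₀ (by positivity) ?_ 2
    have h1 : (T : ℝ) * b ≤ c * d / ε * b := by gcongr
    refine h1.trans ?_
    rw [hb, show c * d / ε * (101 / 100 * ε / c ^ 2) = 101 / 100 * d / c by field_simp]
    exact div_le_self (by positivity) hc
  have he : (2.7 : ℝ) ^ 2 ≤ Real.exp 1 ^ 2 :=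
    pow_le_pow_left₀ (by norm_num) (by linarith [Real.exp_one_gt_d9]) 2
  have hR0 : 3 * (d : ℝ) ^ 2 ≤ (2 * d + 1) * R := by
    have h1 : (d : ℝ) ^ 2 ≤ d ^ 4 := pow_le_pow_right₀ hd1 (by norm_num)
    have h2 : (d : ℝ) ≤ d ^ 3 := by simpa using pow_le_pow_right₀ hd1 (show 1 ≤ 3 by norm_num)
    have h3 : (d : ℝ) ^ 2 ≤ d ^ 3 := pow_le_pow_right₀ hd1 (by norm_num)
    have h4 : (d : ℝ) ^ 2 ≤ R := by linarith
    nlinarith [sq_nonneg (d : ℝ)]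
  have hRpos : 0 ≤ R := by
    by_contra hR1
    push Not at hR1
    nlinarith [sq_nonneg (d : ℝ)]
  have hmain : (T : ℝ) ^ 2 * ((2 * b) ^ 2 *
      ((1 / (2 * Real.exp 1)) ^ 2 * (R / (d ^ 2 * (d + 1) ^ 2)))) ≤
      14 / 100 * (R / (d + 1) ^ 2) := by
    calc _ = ((T : ℝ) * b) ^ 2 * (R / (d ^ 2 * (d + 1) ^ 2)) / Real.exp 1 ^ 2 := by
          field_simp
      _ ≤ (101 / 100 * d) ^ 2 * (R / (d ^ 2 * (d + 1) ^ 2)) / 2.7 ^ 2 := by gcongr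
      _ = (101 / 100) ^ 2 / 2.7 ^ 2 * (R / (d + 1) ^ 2) := by
          field_simp
      _ ≤ _ := by
          exact mul_le_mul_of_nonneg_right (by norm_num) (by positivity)
  have hfin : (2 * d - 1) * (2 * d ^ 2 - 1) / (6 * (2 * d + 1)) ≤
      14 / 100 * (R / ((d : ℝ) + 1) ^ 2) := by
    refine le_trans (le_of_eq ?_) (sub_le_iff_le_add.2 (key.trans (add_le_add_left hmain _)))
    field_simp
    ring
  -- With the denominators cleared, the left side is `(2 d + 1) R - d² + d + 1`, and the right side
  -- is `0.84 (2 d + 1) R`.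
  rw [← mul_div_assoc, div_le_div_iff₀ (by positivity) (by positivity)] at hfin
  nlinarith
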